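/- Let $n\ge 1$ and let $(X_1,\dots,X_n)$ have a symmetric multivariate normal distribution with a common nonnegative correlation, i.e. it is jointly normal with a common mean $E X_i=m\in\mathbb R$, a common variance $\operatorname{Var}X_i=\sigma^2>0$ and $\operatorname{Cov}(X_i,X_j)=\rho\sigma^2$ for all $i\ne j$, where $\rho\ge 0$. Let $(Y_1,\dots,Y_n)$ be either $(X_1,\dots,X_n)$ or, when $m=0$, $(|X_1|,\dots,|X_n|)$. Let $Y_{1:n}\le\dots\le Y_{n:n}$ be the ordered values of $Y_1,\dots,Y_n$, and let $1\le k\le n$. Then the cdf $F_k(x)=P\{\max_{i\in S}Y_i\le x\}$ of the maximum and the cdf $G_k(x)=P\{\min_{i\in S}Y_i\le x\}$ of the minimum of $k$ of the $Y_i$'s are the same for all $S\subseteq\{1,\dots,n\}$ with $|S|=k$, and the following generalized Simes inequalities hold. (a) For all real $a_k\le\dots\le a_n$ such that $\binom jk^{-1}F_k(a_j)$ is nondecreasing in $j=k,\dots,n$, $$P\{Y_{k:n}\ge a_k,\dots,Y_{n:n}\ge a_n\}\ \ge\ 1-F_k(a_n),$$ and equality holds if $Y_1,\dots,Y_n$ are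 independent and $\binom jk^{-1}F_k(a_j)$ is constant in $j=k,\dots,n$. (b) For all real $b_1\le\dots\le b_{n-k+1}$ such that $\binom jk^{-1}\,[1-G_k(b_{n-j+1})]$ is nondecreasing in $j=k,\dots,n$, $$P\{Y_{1:n}\le b_1,\dots,Y_{n-k+1:n}\le b_{n-k+1}\}\ \ge\ G_k(b_1),$$ and equality holds if $Y_1,\dots,Y_n$ are independent and $\binom jk^{-1}\,[1-G_k(b_{n-j+1})]$ is constant in $j=k,\dots,n$. -/

import Mathlib

open MeasureTheory ProbabilityTheory

/-- The order statistics `x_{1:n} ≤ ⋯ ≤ x_{n:n}` of a vector of reals: `orderStat x i` is the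
`(i+1)`-st smallest coordinate, i.e. `x_{i+1:n}` (positions in `Fin n` start at `0`). -/
noncomputable def orderStat {n : ℕ} (x : Fin n → ℝ) (i : Fin n) : ℝ :=
  x (Tuple.sort x i)

/-- The cdf `t ↦ P{max_{i ∈ S} Y_i ≤ t}` of the maximum of the subfamily indexed by `S`. -/
noncomputable def maxCdf {Ω : Type*} [MeasurableSpace Ω] {n : ℕ} (Y : Fin n → Ω → ℝ)
    (P : Measure Ω) (S : Finset (Fin n)) (hS : S.Nonempty) (t : ℝ) : ℝ :=
  P.real {ω | S.sup' hS (fun i => Y i ω) ≤ t}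

/-- The cdf `t ↦ P{min_{i ∈ S} Y_i ≤ t}` of the minimum of the subfamily indexed by `S`. -/
noncomputable def minCdf {Ω : Type*} [MeasurableSpace Ω] {n : ℕ} (Y : Fin n → Ω → ℝ)
    (P : Measure Ω) (S : Finset (Fin n)) (hS : S.Nonempty) (t : ℝ) : ℝ :=
  P.real {ω | S.inf' hS (fun i => Y i ω) ≤ t}

/-- The lower generalized Simes inequality, with `F` in the role of the cdf of the maximum of `k` of
the variables: if `a_k ≤ ⋯ ≤ a_n` and `F(a_j) / C(j,k)` is nondecreasing in `j = k, …, n`, then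
`P{Y_{k:n} ≥ a_k, …, Y_{n:n} ≥ a_n} ≥ 1 - F(a_n)`, with equality if moreover the `Y_i` are
independent and `F(a_j) / C(j,k)` is constant in `j = k, …, n`.
Only the values `a j` with `k ≤ j ≤ n` matter. -/
def SimesLower {Ω : Type*} [MeasurableSpace Ω] {n : ℕ} (Y : Fin n → Ω → ℝ) (P : Measure Ω)
    (k : ℕ) (F : ℝ → ℝ) : Prop :=
  ∀ a : ℕ → ℝ, MonotoneOn a (Set.Icc k n) →
    MonotoneOn (fun j : ℕ => F (a j) / (j.choose k : ℝ)) (Set.Icc k n) →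
    1 - F (a n) ≤
        P.real {ω | ∀ i : Fin n, k ≤ (i : ℕ) + 1 → a (i + 1) ≤ orderStat (fun l => Y l ω) i} ∧
      (iIndepFun Y P →
        (∀ i ∈ Set.Icc k n, ∀ j ∈ Set.Icc k n,
          F (a i) / (i.choose k : ℝ) = F (a j) / (j.choose k : ℝ)) →
        P.real {ω | ∀ i : Fin n, k ≤ (i : ℕ) + 1 → a (i + 1) ≤ orderStat (fun l => Y l ω) i}
          = 1 - F (a n))

/-- The upper generalized Simes inequality, with `G` in the role of the cdf of the minimum of `k` of
the variables: if `b_1 ≤ ⋯ ≤ b_{n-k+1}` and `(1 - G(b_{n-j+1})) / C(j,k)` is nondecreasing in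
`j = k, …, n`, then `P{Y_{1:n} ≤ b_1, …, Y_{n-k+1:n} ≤ b_{n-k+1}} ≥ G(b_1)`, with equality if
moreover the `Y_i` are independent and `(1 - G(b_{n-j+1})) / C(j,k)` is constant in `j = k, …, n`.
It is used for `1 ≤ k ≤ n` only, and only the values `b j` with `1 ≤ j ≤ n - k + 1` matter. -/
def SimesUpper {Ω : Type*} [MeasurableSpace Ω] {n : ℕ} (Y : Fin n → Ω → ℝ) (P : Measure Ω)
    (k : ℕ) (G : ℝ → ℝ) : Prop :=
  ∀ b : ℕ → ℝ, MonotoneOn b (Set.Icc 1 (n - k + 1)) →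
    MonotoneOn (fun j : ℕ => (1 - G (b (n - j + 1))) / (j.choose k : ℝ)) (Set.Icc k n) →
    G (b 1) ≤
        P.real {ω | ∀ i : Fin n, (i : ℕ) + 1 ≤ n - k + 1 →
          orderStat (fun l => Y l ω) i ≤ b (i + 1)} ∧
      (iIndepFun Y P →
        (∀ i ∈ Set.Icc k n, ∀ j ∈ Set.Icc k n,
          (1 - G (b (n - i + 1))) / (i.choose k : ℝ) =
            (1 - G (b (n - j + 1))) / (j.choose k : ℝ)) →
        P.real {ω | ∀ i : Fin n, (i : ℕ) + 1 ≤ n - k + 1 →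
          orderStat (fun l => Y l ω) i ≤ b (i + 1)} = G (b 1))

/-- The generalized Simes inequality for symmetrically distributed `Y_1, …, Y_n`: for every
`1 ≤ k ≤ n`, the cdfs of the maximum and of the minimum of `k` of the `Y_i` do not depend on the
choice of the `k` indices, and both forms of the inequality hold with these common cdfs. -/
def GeneralizedSimes {Ω : Type*} [MeasurableSpace Ω] {n : ℕ} (Y : Fin n → Ω → ℝ)
    (P : Measure Ω) : Prop :=
  ∀ k : ℕ, 1 ≤ k → k ≤ n →
    ∀ (S : Finset (Fin n)) (hS : S.Nonempty), S.card = k →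
      (∀ (T : Finset (Fin n)) (hT : T.Nonempty), T.card = k →
        maxCdf Y P T hT = maxCdf Y P S hS ∧ minCdf Y P T hT = minCdf Y P S hS) ∧
      SimesLower Y P k (maxCdf Y P S hS) ∧
      SimesUpper Y P k (minCdf Y P S hS)

/-- `(X_1, …, X_n)` is jointly normal with common mean `m`, common variance `σ ^ 2` and common
correlation `ρ`; for `σ > 0` these are the symmetric (permutation invariant) normal vectors with
nondegenerate coordinates. -/
structure IsSymmetricNormal {Ω : Type*} [MeasurableSpace Ω] {n : ℕ} (X : Fin n → Ω → ℝ)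
    (m σ ρ : ℝ) (P : Measure Ω) : Prop where
  gaussian : HasGaussianLaw (fun ω i => X i ω) P
  mean : ∀ i, ∫ ω, X i ω ∂P = m
  var : ∀ i, variance (X i) P = σ ^ 2
  cov : ∀ i j, i ≠ j → covariance (X i) (X j) P = ρ * σ ^ 2

/-! The complement of the event in (a) is `someCountExceeds a univ 0 k`: for some i ≥ k, at least i
coordinates lie below a_i. Split it by the largest such i, say j. Then exactly j coordinates lie
below a_j, so exactly C(j,k) of the k-subsets S lie entirely below a_j, and averaging over S gives
the identity `measureReal_someCountExceeds_eq_sum`. Once S is below a_j, what remains is an event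
D_j on the coordinates outside S.

For fixed S put α_j = F_k(a_j)/C(j,k), and let c be the conditional probability of D_{j+1} given
that S is below a_{j+1}. If c is at most the same probability given that S is below a_j, the two
terms containing D_{j+1} contribute at most c(α_{j+1} - α_j) ≤ α_{j+1} - α_j. The sum telescopes to
α_n, and summing over C(n,k) sets gives F_k(a_n). Under independence and constant α each
contribution is zero, whence equality.

The comparison of conditional probabilities is `DependsPositively`. It holds for mixtures of iid
laws that increase in likelihood ratio with the mixing parameter
(`IsMonotoneMixture.dependsPositively`). A symmetric normal vector is such a mixture, since it has
the law of Z + ε_i with a shared normal Z; absolute values give one ordered by |z|. Part (b) is part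
(a)'s argument for -Y, with a_j = -b_{n-j+1}. -/

/-- The event that all coordinates indexed by `S` are smaller than `t`. -/
def allBelow {n : ℕ} (S : Finset (Fin n)) (t : ℝ) : Set (Fin n → ℝ) := {y | ∀ i ∈ S, y i < t}

/-- The event that, for some `i` with `j ≤ i ≤ n`, at least `i - c` of the coordinates indexed
by `T` are smaller than `a i`. -/
def someCountExceeds {n : ℕ} (a : ℕ → ℝ) (T : Finset (Fin n)) (c j : ℕ) : Set (Fin n → ℝ) :=
  {y | ∃ i, j ≤ i ∧ i ≤ n ∧ i ≤ c + (T.filter fun l => y l < a i).card}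

/-! ### Counting events -/

section Events

variable {n : ℕ}

lemma measurableSet_allBelow (S : Finset (Fin n)) (t : ℝ) : MeasurableSet (allBelow S t) := by
  unfold allBelow
  measurability

lemma allBelow_mono (S : Finset (Fin n)) {s t : ℝ} (h : s ≤ t) : allBelow S s ⊆ allBelow S t :=
  fun _ hy i hi => (hy i hi).trans_le h

lemma measurable_card_filter_lt (T : Finset (Fin n)) (t : ℝ) :
    Measurable fun y : Fin n → ℝ => (T.filter fun l => y l < t).card := by
  simp_rw [Finset.card_filter]
  refine Finset.measurable_sum _ fun l _ => ?_
  exact Measurable.ite (measurableSet_lt (measurable_pi_apply l) measurable_const)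
    measurable_const measurable_const

lemma measurableSet_someCountExceeds (a : ℕ → ℝ) (T : Finset (Fin n)) (c j : ℕ) :
    MeasurableSet (someCountExceeds a T c j) := by
  have : someCountExceeds a T c j = ⋃ i ∈ Set.Icc j n,
      {y | i ≤ c + (T.filter fun l => y l < a i).card} := by
    ext y
    simp [someCountExceeds, and_assoc]
  rw [this]
  refine MeasurableSet.biUnion (Set.to_countable _) fun i _ => ?_
  exact measurableSet_le measurable_const ((measurable_card_filter_lt T (a i)).const_add c)

lemma isLowerSet_someCountExceeds (a : ℕ → ℝ) (T : Finset (Fin n)) (c j : ℕ) :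
    IsLowerSet (someCountExceeds a T c j) := by
  rintro y z hzy ⟨i, hji, hin, hi⟩
  refine ⟨i, hji, hin, hi.trans ?_⟩
  gcongr with l
  exact hzy l

lemma someCountExceeds_congr (a : ℕ → ℝ) (T : Finset (Fin n)) (c j : ℕ) {y z : Fin n → ℝ}
    (h : ∀ i ∈ T, y i = z i) (hy : y ∈ someCountExceeds a T c j) :
    z ∈ someCountExceeds a T c j := by
  obtain ⟨i, hji, hin, hi⟩ := hy
  refine ⟨i, hji, hin, ?_⟩
  rwa [Finset.filter_congr (q := fun l => y l < a i) fun l hl => by rw [h l hl]]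

lemma someCountExceeds_anti (a : ℕ → ℝ) (T : Finset (Fin n)) (c : ℕ) {i j : ℕ} (h : i ≤ j) :
    someCountExceeds a T c j ⊆ someCountExceeds a T c i :=
  fun _ ⟨l, hl, hl'⟩ => ⟨l, h.trans hl, hl'⟩

lemma someCountExceeds_eq_empty (a : ℕ → ℝ) (T : Finset (Fin n)) (c : ℕ) {j : ℕ} (h : n < j) :
    someCountExceeds a T c j = ∅ := by
  ext y
  simp only [someCountExceeds, Set.mem_ofPred_eq, Set.mem_empty_iff_false, iff_false]
  rintro ⟨i, h1, h2, -⟩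
  omega

lemma someCountExceeds_self (a : ℕ → ℝ) (T : Finset (Fin n)) {k : ℕ} (h : k ≤ n) :
    someCountExceeds a T k k = Set.univ :=
  Set.eq_univ_of_forall fun _ => ⟨k, le_rfl, h, Nat.le_add_right _ _⟩

/-- The k coordinates in S lie below a_j, hence below every later a_l, so they can be replaced by
the constant k. The event then depends only on the coordinates outside S. -/
lemma mem_someCountExceeds_univ_iff {a : ℕ → ℝ} {k i j : ℕ} {S : Finset (Fin n)} (hS : S.card = k)
    (ha : MonotoneOn a (Set.Icc k n)) (hkj : k ≤ j) (hij : j ≤ i) {y : Fin n → ℝ}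
    (hy : y ∈ allBelow S (a j)) :
    y ∈ someCountExceeds a Finset.univ 0 i ↔ y ∈ someCountExceeds a Sᶜ k i := by
  refine exists_congr fun l => and_congr_right fun hil => and_congr_right fun hln => ?_
  have hcard : (Finset.univ.filter fun m => y m < a l).card
      = k + (Sᶜ.filter fun m => y m < a l).card := by
    rw [← Finset.union_compl S, Finset.filter_union, Finset.card_union_of_disjoint
      (Finset.disjoint_filter_filter disjoint_compl_right), Finset.filter_true_of_mem, hS]
    intro m hm
    exact (hy m hm).trans_le (ha ⟨hkj, by omega⟩ ⟨by omega, hln⟩ (hij.trans hil))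
  rw [hcard, zero_add]

lemma card_filter_lt_of_mem_diff {a : ℕ → ℝ} {k j : ℕ}
    (ha : MonotoneOn a (Set.Icc k n)) (hkj : k ≤ j) (hjn : j ≤ n) {y : Fin n → ℝ}
    (hy : y ∈ someCountExceeds a Finset.univ 0 j \ someCountExceeds a Finset.univ 0 (j + 1)) :
    (Finset.univ.filter fun l => y l < a j).card = j := by
  obtain ⟨⟨i, hji, hin, hi⟩, h2⟩ := hy
  have hij : i = j := by
    by_contra hne
    exact h2 ⟨i, by omega, hin, hi⟩
  subst hij
  refine le_antisymm ?_ (by simpa using hi)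
  by_contra! hlt
  -- If more than j coordinates were below a_j, then j + 1 would also be a witness, by monotonicity
  -- of a; for j = n there are not enough coordinates.
  rcases hjn.eq_or_lt with rfl | hlt'
  · have := Finset.card_filter_le (Finset.univ : Finset (Fin i)) fun l => y l < a i
    simp only [Finset.card_univ, Fintype.card_fin] at this
    omega
  · refine h2 ⟨i + 1, le_rfl, hlt', ?_⟩
    rw [zero_add]
    refine hlt.trans_le (Finset.card_le_card ?_)
    gcongr with l
    exact ha ⟨hkj, hjn⟩ ⟨by omega, hlt'⟩ (Nat.le_succ i)

end Events

/-! ### Summation by parts -/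

/-- Regroups the sum so that g_j meets f_{j+1}; the increments of α then telescope. -/
lemma sum_Icc_sub_le_of_le {f g α : ℕ → ℝ} {k n : ℕ} (hk : k ≤ n) (h0 : f k ≤ α k) (hn : g n = 0)
    (h : ∀ j, k ≤ j → j < n → f (j + 1) - g j ≤ α (j + 1) - α j) :
    ∑ j ∈ Finset.Icc k n, (f j - g j) ≤ α n := by
  suffices H : ∀ m, k ≤ m → m ≤ n → ∑ j ∈ Finset.Icc k m, (f j - g j) + g m ≤ α m by
    simpa [hn] using H n hk le_rfl
  intro m hm
  induction m, hm using Nat.le_induction with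
  | base => intro _; simpa using h0
  | succ m hm ih =>
    intro hmn
    rw [Finset.sum_Icc_succ_top (by omega)]
    have := ih (by omega)
    have := h m hm (by omega)
    linarith

lemma sum_Icc_sub_eq_of_eq {f g α : ℕ → ℝ} {k n : ℕ} (hk : k ≤ n) (h0 : f k = α k) (hn : g n = 0)
    (h : ∀ j, k ≤ j → j < n → f (j + 1) - g j = α (j + 1) - α j) :
    ∑ j ∈ Finset.Icc k n, (f j - g j) = α n := by
  have h1 := sum_Icc_sub_le_of_le hk h0.le hn fun j hj hj' => (h j hj hj').le
  have h2 := sum_Icc_sub_le_of_le (f := fun j => - f j) (g := fun j => - g j)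
    (α := fun j => - α j) hk (by simp [h0]) (by simp [hn])
    fun j hj hj' => by have := h j hj hj'; linarith
  have h3 : ∑ j ∈ Finset.Icc k n, (- f j - - g j) = - ∑ j ∈ Finset.Icc k n, (f j - g j) := by
    rw [← Finset.sum_neg_distrib]
    exact Finset.sum_congr rfl fun _ _ => by ring
  linarith

/-! ### The Simes inequality under positive dependence -/

section Core

variable {n : ℕ} (μ : Measure (Fin n → ℝ)) [IsProbabilityMeasure μ]

/-- Double counting: each point of A lies in `allBelow S t` for precisely the k-subsets S of its j
coordinates below t. -/
lemma sum_measureReal_inter_allBelow {j k : ℕ} {t : ℝ} {A : Set (Fin n → ℝ)} (hA : MeasurableSet A)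
    (hcard : ∀ y ∈ A, (Finset.univ.filter fun l => y l < t).card = j) :
    ∑ S ∈ (Finset.univ : Finset (Fin n)).powersetCard k, μ.real (A ∩ allBelow S t)
      = j.choose k * μ.real A := by
  have hm (S : Finset (Fin n)) : MeasurableSet (A ∩ allBelow S t) :=
    hA.inter (measurableSet_allBelow S t)
  have h1 (S : Finset (Fin n)) :
      μ.real (A ∩ allBelow S t) = ∫ y, (A ∩ allBelow S t).indicator (fun _ => (1 : ℝ)) y ∂μ := by
    rw [integral_indicator (hm S)]
    simp
  simp_rw [h1]
  rw [← integral_finsetSum _ fun S _ => (integrable_const (1 : ℝ)).indicator (hm S)]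
  have h2 : (fun y => ∑ S ∈ (Finset.univ : Finset (Fin n)).powersetCard k,
      (A ∩ allBelow S t).indicator (fun _ => (1 : ℝ)) y)
      = A.indicator fun _ => (j.choose k : ℝ) := by
    ext y
    by_cases hy : y ∈ A
    · rw [Set.indicator_of_mem hy, ← hcard y hy, ← Finset.card_powersetCard]
      classical
      simp only [Set.indicator_apply]
      rw [← Finset.sum_filter, Finset.sum_const, nsmul_eq_mul, mul_one]
      congr 2
      ext S
      simp only [Finset.mem_filter, Finset.mem_powersetCard, true_and,
        Set.mem_inter_iff, hy, allBelow, Set.mem_ofPred_eq, Finset.subset_iff, Finset.mem_univ]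
      tauto
    · simp [hy]
  rw [h2, integral_indicator hA]
  simp [mul_comm]

lemma measureReal_someCountExceeds_eq_sum {k : ℕ} (hk : k ≤ n) (a : ℕ → ℝ)
    (ha : MonotoneOn a (Set.Icc k n)) :
    μ.real (someCountExceeds a Finset.univ 0 k)
      = ∑ S ∈ (Finset.univ : Finset (Fin n)).powersetCard k, ∑ j ∈ Finset.Icc k n,
        (μ.real (someCountExceeds a Sᶜ k j ∩ allBelow S (a j))
          - μ.real (someCountExceeds a Sᶜ k (j + 1) ∩ allBelow S (a j))) / j.choose k := by
  set U := someCountExceeds (n := n) a Finset.univ 0 with hU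
  have hUm (j : ℕ) : MeasurableSet (U j) := measurableSet_someCountExceeds a _ 0 j
  have hdiff (j : ℕ) : μ.real (U j \ U (j + 1)) = μ.real (U j) - μ.real (U (j + 1)) :=
    measureReal_sdiff (someCountExceeds_anti a _ 0 (Nat.le_succ j)) (hUm _)
  have htel : μ.real (U k) = ∑ j ∈ Finset.Icc k n, μ.real (U j \ U (j + 1)) := by
    simp_rw [hdiff]
    exact (sum_Icc_sub_eq_of_eq (α := fun _ => μ.real (U k)) hk rfl
      (by simp [hU, someCountExceeds_eq_empty]) fun _ _ _ => by ring).symm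
  rw [htel, Finset.sum_comm]
  refine Finset.sum_congr rfl fun j hj => ?_
  rw [Finset.mem_Icc] at hj
  have hpos : (0 : ℝ) < j.choose k := by exact_mod_cast Nat.choose_pos hj.1
  have hsum := sum_measureReal_inter_allBelow μ (k := k) ((hUm j).diff (hUm (j + 1)))
    (fun y hy => card_filter_lt_of_mem_diff ha hj.1 hj.2 hy)
  rw [← Finset.sum_div, eq_div_iff hpos.ne', mul_comm, ← hsum]
  refine Finset.sum_congr rfl fun S hS => ?_
  rw [Finset.mem_powersetCard] at hS
  have hset : (U j \ U (j + 1)) ∩ allBelow S (a j)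
      = (someCountExceeds a Sᶜ k j ∩ allBelow S (a j))
        \ (someCountExceeds a Sᶜ k (j + 1) ∩ allBelow S (a j)) := by
    ext y
    by_cases hy : y ∈ allBelow S (a j)
    · have h1 := mem_someCountExceeds_univ_iff hS.2 ha hj.1 le_rfl hy
      have h2 := mem_someCountExceeds_univ_iff hS.2 ha hj.1 (Nat.le_succ j) hy
      simp [hU, hy, h1, h2]
    · simp [hy]
  rw [hset, measureReal_sdiff]
  · exact Set.inter_subset_inter_left _ (someCountExceeds_anti a _ k (Nat.le_succ j))
  · exact (measurableSet_someCountExceeds a _ k _).inter (measurableSet_allBelow S _)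

/-- A lower set not depending on the coordinates in `S` is the less likely, given that these
coordinates are all below `t`, the larger `t` is. -/
def DependsPositively (S : Finset (Fin n)) : Prop :=
  ∀ D : Set (Fin n → ℝ), MeasurableSet D → IsLowerSet D →
    (∀ y z : Fin n → ℝ, (∀ i ∈ Sᶜ, y i = z i) → y ∈ D → z ∈ D) → ∀ s t : ℝ, s ≤ t →
      μ.real (D ∩ allBelow S t) * μ.real (allBelow S s)
        ≤ μ.real (D ∩ allBelow S s) * μ.real (allBelow S t)

theorem measureReal_someCountExceeds_le {k : ℕ} (hk : k ≤ n) (p : ℝ → ℝ)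
    (hp : ∀ S : Finset (Fin n), S.card = k → ∀ t, μ.real (allBelow S t) = p t)
    (hpos : ∀ S : Finset (Fin n), S.card = k → DependsPositively μ S)
    (a : ℕ → ℝ) (ha : MonotoneOn a (Set.Icc k n))
    (hα : MonotoneOn (fun j : ℕ => p (a j) / (j.choose k : ℝ)) (Set.Icc k n)) :
    μ.real (someCountExceeds a Finset.univ 0 k) ≤ p (a n) := by
  have hn : (0 : ℝ) < n.choose k := by exact_mod_cast Nat.choose_pos hk
  rw [measureReal_someCountExceeds_eq_sum μ hk a ha]
  have key : ∀ S ∈ (Finset.univ : Finset (Fin n)).powersetCard k, ∑ j ∈ Finset.Icc k n,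
        (μ.real (someCountExceeds a Sᶜ k j ∩ allBelow S (a j))
          - μ.real (someCountExceeds a Sᶜ k (j + 1) ∩ allBelow S (a j))) / j.choose k
        ≤ p (a n) / n.choose k := by
    intro S hS
    rw [Finset.mem_powersetCard] at hS
    simp_rw [sub_div]
    refine sum_Icc_sub_le_of_le (α := fun j => p (a j) / j.choose k) hk ?_ ?_ fun j hkj hjn => ?_
    · simp [someCountExceeds_self a Sᶜ hk, hp S hS.2]
    · simp [someCountExceeds_eq_empty]
    have hj : (0 : ℝ) < j.choose k := by exact_mod_cast Nat.choose_pos hkj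
    have hj1 : (0 : ℝ) < (j + 1).choose k := by exact_mod_cast Nat.choose_pos (by omega)
    have hajj : a j ≤ a (j + 1) := ha ⟨hkj, by omega⟩ ⟨by omega, hjn⟩ (Nat.le_succ j)
    have hαj : p (a j) / j.choose k ≤ p (a (j + 1)) / (j + 1).choose k :=
      hα ⟨hkj, by omega⟩ ⟨by omega, hjn⟩ (Nat.le_succ j)
    set D := someCountExceeds a Sᶜ k (j + 1) with hD
    have hdep := hpos S hS.2 D (measurableSet_someCountExceeds a _ k _)
      (isLowerSet_someCountExceeds a _ k _)
      (fun y z h => someCountExceeds_congr a _ k _ h) _ _ hajj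
    rw [hp S hS.2, hp S hS.2] at hdep
    have hq1 : μ.real (D ∩ allBelow S (a (j + 1))) ≤ p (a (j + 1)) := by
      rw [← hp S hS.2]
      exact measureReal_mono Set.inter_subset_right
    have hq0 : 0 ≤ μ.real (D ∩ allBelow S (a (j + 1))) := measureReal_nonneg
    have hq0' : 0 ≤ μ.real (D ∩ allBelow S (a j)) := measureReal_nonneg
    -- A null conditioning event is treated apart, since c below divides by its probability.
    rcases (hq0.trans hq1).eq_or_lt with h0 | h0
    · have hz : p (a j) = 0 := by
        refine le_antisymm ?_ ?_
        · rw [h0, ← hp S hS.2, ← hp S hS.2]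
          exact measureReal_mono (allBelow_mono S hajj)
        · rw [← hp S hS.2]
          exact measureReal_nonneg
      rw [le_antisymm (hq1.trans h0.ge) hq0, hz, ← h0]
      simp only [zero_div, zero_sub, sub_zero, neg_nonpos]
      positivity
    · set c := μ.real (D ∩ allBelow S (a (j + 1))) / p (a (j + 1)) with hc
      have hc0 : 0 ≤ c := by positivity
      have hc1 : c ≤ 1 := (div_le_one h0).2 hq1
      have e1 : μ.real (D ∩ allBelow S (a (j + 1))) = c * p (a (j + 1)) := by
        rw [hc]; field_simp
      have e2 : c * p (a j) ≤ μ.real (D ∩ allBelow S (a j)) := by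
        rw [hc, div_mul_eq_mul_div, div_le_iff₀ h0]
        exact hdep
      have e3 : c * (p (a j) / j.choose k) ≤ μ.real (D ∩ allBelow S (a j)) / j.choose k := by
        rw [← mul_div_assoc]
        gcongr
      rw [e1, mul_div_assoc]
      -- Combines `e3` with (1 - c)(α_{j+1} - α_j) ≥ 0.
      nlinarith
  refine (Finset.sum_le_sum key).trans_eq ?_
  rw [Finset.sum_const, Finset.card_powersetCard, Finset.card_univ, Fintype.card_fin, nsmul_eq_mul,
    mul_div_cancel₀ _ hn.ne']

theorem measureReal_someCountExceeds_eq {k : ℕ} (hk : k ≤ n) (p : ℝ → ℝ)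
    (hp : ∀ S : Finset (Fin n), S.card = k → ∀ t, μ.real (allBelow S t) = p t)
    (hind : ∀ (S : Finset (Fin n)) (D : Set (Fin n → ℝ)), MeasurableSet D →
      (∀ y z : Fin n → ℝ, (∀ i ∈ Sᶜ, y i = z i) → y ∈ D → z ∈ D) → ∀ t,
        μ.real (D ∩ allBelow S t) = μ.real D * μ.real (allBelow S t))
    (a : ℕ → ℝ) (ha : MonotoneOn a (Set.Icc k n))
    (hα : ∀ i ∈ Set.Icc k n, ∀ j ∈ Set.Icc k n,
      p (a i) / (i.choose k : ℝ) = p (a j) / (j.choose k : ℝ)) :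
    μ.real (someCountExceeds a Finset.univ 0 k) = p (a n) := by
  have hn : (0 : ℝ) < n.choose k := by exact_mod_cast Nat.choose_pos hk
  rw [measureReal_someCountExceeds_eq_sum μ hk a ha]
  have key : ∀ S ∈ (Finset.univ : Finset (Fin n)).powersetCard k, ∑ j ∈ Finset.Icc k n,
        (μ.real (someCountExceeds a Sᶜ k j ∩ allBelow S (a j))
          - μ.real (someCountExceeds a Sᶜ k (j + 1) ∩ allBelow S (a j))) / j.choose k
        = p (a n) / n.choose k := by
    intro S hS
    rw [Finset.mem_powersetCard] at hS
    have hmul (i : ℕ) (t : ℝ) : μ.real (someCountExceeds a Sᶜ k i ∩ allBelow S t)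
        = μ.real (someCountExceeds a Sᶜ k i) * p t := by
      rw [hind S _ (measurableSet_someCountExceeds a _ k _)
        (fun y z h => someCountExceeds_congr a _ k _ h), hp S hS.2]
    simp_rw [sub_div, hmul, mul_div_assoc]
    refine sum_Icc_sub_eq_of_eq (α := fun j => p (a j) / j.choose k) hk ?_ ?_ fun j hkj hjn => ?_
    · simp [someCountExceeds_self a Sᶜ hk]
    · simp [someCountExceeds_eq_empty]
    · rw [hα (j + 1) ⟨by omega, hjn⟩ j ⟨hkj, by omega⟩]
      ring
  rw [Finset.sum_congr rfl key, Finset.sum_const, Finset.card_powersetCard, Finset.card_univ,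
    Fintype.card_fin, nsmul_eq_mul, mul_div_cancel₀ _ hn.ne']

end Core

/-! ### Product measures: independence of blocks and stochastic order -/

section ProductMeasures

variable {n : ℕ}

lemma pi_inter_allBelow (κ : Fin n → Measure ℝ) [∀ i, IsProbabilityMeasure (κ i)]
    (S : Finset (Fin n)) {D : Set (Fin n → ℝ)} (hD : MeasurableSet D)
    (hdep : ∀ y z : Fin n → ℝ, (∀ i ∈ Sᶜ, y i = z i) → y ∈ D → z ∈ D) (t : ℝ) :
    Measure.pi κ (D ∩ allBelow S t) = Measure.pi κ D * Measure.pi κ (allBelow S t) := by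
  have hind : iIndepFun (fun i (y : Fin n → ℝ) => y i) (Measure.pi κ) :=
    iIndepFun_pi (X := fun _ => id) fun _ => aemeasurable_id
  have hi := hind.indepFun_finset Sᶜ S disjoint_compl_left fun i => measurable_pi_apply i
  -- Extension by an arbitrary value, 0, on S: it exhibits D as the preimage of a set of vectors
  -- indexed by Sᶜ.
  let e : ((Sᶜ : Finset (Fin n)) → ℝ) → Fin n → ℝ := fun w i => if h : i ∈ Sᶜ then w ⟨i, h⟩ else 0
  have he : Measurable e := by
    refine measurable_pi_lambda _ fun i => ?_
    by_cases h : i ∈ Sᶜ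
    · simpa only [e, h, dif_pos] using measurable_pi_apply _
    · simpa only [e, h, dif_neg, not_false_eq_true] using measurable_const
  have h1 : (fun (y : Fin n → ℝ) (i : (Sᶜ : Finset (Fin n))) => y i) ⁻¹' (e ⁻¹' D) = D := by
    ext y
    have hy : ∀ i ∈ Sᶜ, e (fun i => y i) i = y i := fun i hi => by simp only [e, dif_pos hi]
    exact ⟨hdep _ _ hy, hdep _ _ fun i hi => (hy i hi).symm⟩
  have h2 : (fun (y : Fin n → ℝ) (i : S) => y i) ⁻¹' (Set.univ.pi fun _ => Set.Iio t)
      = allBelow S t := by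
    ext y
    simp [allBelow]
  have := hi.measure_inter_preimage_eq_mul _ _ (he hD)
    (MeasurableSet.univ_pi fun _ : S => measurableSet_Iio (a := t))
  rwa [h1, h2] at this

lemma pi_allBelow (κ : Measure ℝ) [IsProbabilityMeasure κ] (S : Finset (Fin n)) (t : ℝ) :
    Measure.pi (fun _ : Fin n => κ) (allBelow S t) = κ (Set.Iio t) ^ S.card := by
  have h : allBelow S t = Set.univ.pi fun i => if i ∈ S then Set.Iio t else Set.univ := by
    ext y
    simp only [allBelow, Set.mem_ofPred_eq, Set.mem_pi, Set.mem_univ, true_implies]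
    refine forall_congr' fun i => ?_
    by_cases hi : i ∈ S <;> simp [hi]
  rw [h, Measure.pi_pi]
  simp [apply_ite]

/-- Sections of a lower set are lower sets, so by Fubini the factors can be exchanged: n of them by
induction, the last by the one-dimensional hypothesis. -/
lemma pi_le_pi_of_isLowerSet (κ κ' : Measure ℝ) [IsProbabilityMeasure κ] [IsProbabilityMeasure κ']
    (h : ∀ L : Set ℝ, IsLowerSet L → κ' L ≤ κ L) {D : Set (Fin n → ℝ)} (hD : MeasurableSet D)
    (hlow : IsLowerSet D) :
    Measure.pi (fun _ : Fin n => κ') D ≤ Measure.pi (fun _ : Fin n => κ) D := by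
  induction n with
  | zero =>
    rw [Measure.pi_of_empty, Measure.pi_of_empty]
  | succ n ih =>
    have split (κ : Measure ℝ) [IsProbabilityMeasure κ] : Measure.pi (fun _ : Fin (n + 1) => κ) D
        = (κ.prod (Measure.pi fun _ : Fin n => κ))
          ((MeasurableEquiv.piFinSuccAbove (fun _ => ℝ) 0).symm ⁻¹' D) :=
      ((measurePreserving_piFinSuccAbove (fun _ : Fin (n + 1) => κ) 0).symm.measure_preimage_equiv
        D).symm
    set E := (MeasurableEquiv.piFinSuccAbove (fun _ : Fin (n + 1) => ℝ) 0).symm ⁻¹' D with hE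
    have hEm : MeasurableSet E := MeasurableEquiv.measurable _ hD
    have hElow : IsLowerSet E := by
      intro x y hxy hx
      refine hlow ?_ hx
      exact (Fin.insertNthOrderIso (fun _ : Fin (n + 1) => ℝ) 0).monotone hxy
    rw [split, split]
    calc κ'.prod (Measure.pi fun _ : Fin n => κ') E
        = ∫⁻ x, Measure.pi (fun _ : Fin n => κ') (Prod.mk x ⁻¹' E) ∂κ' := Measure.prod_apply hEm
      _ ≤ ∫⁻ x, Measure.pi (fun _ : Fin n => κ) (Prod.mk x ⁻¹' E) ∂κ' := by
        refine lintegral_mono fun x => ih (measurable_prodMk_left hEm) fun y z hyz hy => ?_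
        exact hElow (Prod.mk_le_mk.2 ⟨le_rfl, hyz⟩) hy
      _ = κ'.prod (Measure.pi fun _ : Fin n => κ) E := (Measure.prod_apply hEm).symm
      _ = ∫⁻ y, κ' ((fun x => (x, y)) ⁻¹' E) ∂(Measure.pi fun _ : Fin n => κ) :=
        Measure.prod_apply_symm hEm
      _ ≤ ∫⁻ y, κ ((fun x => (x, y)) ⁻¹' E) ∂(Measure.pi fun _ : Fin n => κ) := by
        refine lintegral_mono fun y => h _ fun x z hxz hx => ?_
        exact hElow (Prod.mk_le_mk.2 ⟨hxz, le_rfl⟩) hx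
      _ = κ.prod (Measure.pi fun _ : Fin n => κ) E := (Measure.prod_apply_symm hEm).symm

end ProductMeasures

/-! ### Likelihood ratio order -/

section LikelihoodRatio

/-- The likelihood ratio order on measures on the line, in terms of sets: `κ'` puts relatively more
mass on the larger of two separated sets than `κ` does. -/
def LikelihoodRatioLE (κ κ' : Measure ℝ) : Prop :=
  ∀ A B : Set ℝ, MeasurableSet A → MeasurableSet B → (∀ x ∈ A, ∀ y ∈ B, x < y) →
    κ' A * κ B ≤ κ A * κ' B

namespace LikelihoodRatioLE

variable {κ κ' : Measure ℝ}

lemma map_neg (h : LikelihoodRatioLE κ κ') :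
    LikelihoodRatioLE (κ'.map fun x => -x) (κ.map fun x => -x) := by
  intro A B hA hB hAB
  rw [Measure.map_apply measurable_neg hA, Measure.map_apply measurable_neg hA,
    Measure.map_apply measurable_neg hB, Measure.map_apply measurable_neg hB]
  exact (mul_comm _ _).trans_le <| (h _ _ (measurable_neg hB) (measurable_neg hA)
    fun x hx y hy => by have := hAB _ hy _ hx; linarith).trans_eq (mul_comm _ _)

/-- After splitting `Iio t` at s the common product cancels, leaving the separated sets `Iio s` and
`Ico s t`. -/
lemma Iio_mul_Iio_le (h : LikelihoodRatioLE κ κ') {s t : ℝ} (hst : s ≤ t) :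
    κ' (Set.Iio s) * κ (Set.Iio t) ≤ κ (Set.Iio s) * κ' (Set.Iio t) := by
  have hsplit (κ : Measure ℝ) : κ (Set.Iio t) = κ (Set.Iio s) + κ (Set.Ico s t) := by
    rw [← measure_union ?_ measurableSet_Ico, Set.Iio_union_Ico_eq_Iio hst]
    exact Set.disjoint_left.2 fun x hx hx' => hx'.1.not_gt hx
  rw [hsplit κ, hsplit κ', mul_add, mul_add]
  refine add_le_add (mul_comm _ _).le ?_
  exact h _ _ measurableSet_Iio measurableSet_Ico fun x hx y hy => lt_of_lt_of_le hx hy.1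

variable [IsProbabilityMeasure κ] [IsProbabilityMeasure κ']

lemma measure_le_of_isLowerSet (h : LikelihoodRatioLE κ κ') {L : Set ℝ} (hL : IsLowerSet L) :
    κ' L ≤ κ L := by
  have hm : MeasurableSet L := hL.ordConnected.measurableSet
  have h1 := h L Lᶜ hm hm.compl fun x hx y hy => by
    by_contra! hyx
    exact hy (hL hyx hx)
  rw [prob_compl_eq_one_sub hm, prob_compl_eq_one_sub hm] at h1
  have hκ : κ L ≤ 1 := prob_le_one
  have hκ' : κ' L ≤ 1 := prob_le_one
  rw [← ENNReal.toReal_le_toReal (by finiteness) (by finiteness)] at h1 ⊢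
  rw [ENNReal.toReal_mul, ENNReal.toReal_mul, ENNReal.toReal_sub_of_le hκ (by simp),
    ENNReal.toReal_sub_of_le hκ' (by simp), ENNReal.toReal_one] at h1
  linarith

end LikelihoodRatioLE

lemma setLIntegral_mul_setLIntegral_le {α : Type*} [MeasurableSpace α] {μ : Measure α}
    {f g : α → ENNReal} (hf : Measurable f) (hg : Measurable g) {A B : Set α}
    (hA : MeasurableSet A) (hB : MeasurableSet B)
    (h : ∀ x ∈ A, ∀ y ∈ B, g x * f y ≤ f x * g y) :
    (∫⁻ x in A, g x ∂μ) * ∫⁻ y in B, f y ∂μ ≤ (∫⁻ x in A, f x ∂μ) * ∫⁻ y in B, g y ∂μ := by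
  rw [← lintegral_lintegral_mul hg.aemeasurable hf.aemeasurable,
    ← lintegral_lintegral_mul hf.aemeasurable hg.aemeasurable]
  exact setLIntegral_mono' hA fun x hx => setLIntegral_mono' hB fun y hy => h x hx y hy

end LikelihoodRatio

/-! ### Monotone mixtures and positive dependence -/

section Mixture

variable {Z : Type*} [MeasurableSpace Z] {n : ℕ}

/-- Chebyshev's association inequality: under the weight g, both d and f/g decrease with h. The
proof symmetrizes over two independent copies of z; cross-multiplying avoids dividing by g. -/
lemma integral_mul_integral_le_of_antitone_ratio (ν : Measure Z) [IsProbabilityMeasure ν]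
    {d f g h : Z → ℝ} (hd : Measurable d) (hf : Measurable f) (hg : Measurable g)
    (hd1 : ∀ z, d z ∈ Set.Icc (0 : ℝ) 1) (hf1 : ∀ z, f z ∈ Set.Icc (0 : ℝ) 1)
    (hg1 : ∀ z, g z ∈ Set.Icc (0 : ℝ) 1)
    (hanti : ∀ z z', h z ≤ h z' → d z' ≤ d z)
    (hratio : ∀ z z', h z ≤ h z' → f z' * g z ≤ f z * g z') :
    (∫ z, d z * g z ∂ν) * ∫ z, f z ∂ν ≤ (∫ z, d z * f z ∂ν) * ∫ z, g z ∂ν := by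
  have bdd {u : Z → ℝ} (hu : Measurable u) (hu1 : ∀ z, u z ∈ Set.Icc (0 : ℝ) 1) :
      Integrable u ν :=
    Integrable.of_bound hu.aestronglyMeasurable 1 (ae_of_all _ fun z => by
      rw [Real.norm_of_nonneg (hu1 z).1]
      exact (hu1 z).2)
  have hmul {u v : Z → ℝ} (hu : ∀ z, u z ∈ Set.Icc (0 : ℝ) 1)
      (hv : ∀ z, v z ∈ Set.Icc (0 : ℝ) 1) (z : Z) : u z * v z ∈ Set.Icc (0 : ℝ) 1 :=
    ⟨mul_nonneg (hu z).1 (hv z).1, mul_le_one₀ (hu z).2 (hv z).1 (hv z).2⟩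
  have idf := bdd (hd.mul hf) (hmul hd1 hf1)
  have idg := bdd (hd.mul hg) (hmul hd1 hg1)
  have hf' := bdd hf hf1
  have hg' := bdd hg hg1
  let F : Z × Z → ℝ := fun q => d q.1 * f q.1 * g q.2 - d q.1 * g q.1 * f q.2
  have hF : Integrable F (ν.prod ν) := (idf.mul_prod hg').sub (idg.mul_prod hf')
  have hFint : ∫ q, F q ∂(ν.prod ν)
      = (∫ z, d z * f z ∂ν) * (∫ z, g z ∂ν) - (∫ z, d z * g z ∂ν) * ∫ z, f z ∂ν := by
    rw [← integral_prod_mul, ← integral_prod_mul]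
    exact integral_sub (idf.mul_prod hg') (idg.mul_prod hf')
  have hswap : ∫ q, F q.swap ∂(ν.prod ν) = ∫ q, F q ∂(ν.prod ν) := integral_prod_swap F
  have hnonneg : 0 ≤ ∫ q, (F q + F q.swap) ∂(ν.prod ν) := by
    refine integral_nonneg fun ⟨z, z'⟩ => ?_
    have e : F (z, z') + F (z, z').swap = (d z - d z') * (f z * g z' - f z' * g z) := by
      simp only [F, Prod.swap_prod_mk]
      ring
    change 0 ≤ F (z, z') + F (z, z').swap
    rw [e]
    rcases le_total (h z) (h z') with hz | hz
    · exact mul_nonneg (sub_nonneg.2 (hanti _ _ hz)) (sub_nonneg.2 (hratio _ _ hz))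
    · refine mul_nonneg_of_nonpos_of_nonpos (sub_nonpos.2 (hanti _ _ hz)) ?_
      have := hratio _ _ hz
      linarith
  rw [integral_add hF (by exact hF.swap), hswap] at hnonneg
  linarith

/-- `μ` is a mixture over `ν` of the laws of `n` independent variables with distribution `κ z`,
and `κ` increases in the likelihood ratio order as `h` increases. -/
structure IsMonotoneMixture (μ : Measure (Fin n → ℝ)) (ν : Measure Z) (κ : Z → Measure ℝ)
    (h : Z → ℝ) : Prop where
  prob : ∀ z, IsProbabilityMeasure (κ z)
  measurable : ∀ E, MeasurableSet E → Measurable fun z => Measure.pi (fun _ : Fin n => κ z) E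
  apply : ∀ E, MeasurableSet E → μ E = ∫⁻ z, Measure.pi (fun _ : Fin n => κ z) E ∂ν
  mono : ∀ z z', h z ≤ h z' → LikelihoodRatioLE (κ z) (κ z')

namespace IsMonotoneMixture

variable {μ : Measure (Fin n → ℝ)} {ν : Measure Z} {κ : Z → Measure ℝ} {h : Z → ℝ}

lemma map (hμ : IsMonotoneMixture μ ν κ h) {f : ℝ → ℝ} (hf : Measurable f) {h' : Z → ℝ}
    (hmono : ∀ z z', h' z ≤ h' z' → LikelihoodRatioLE ((κ z).map f) ((κ z').map f)) :
    IsMonotoneMixture (μ.map fun y i => f (y i)) ν (fun z => (κ z).map f) h' := by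
  have := hμ.prob
  have hf' : Measurable fun (y : Fin n → ℝ) i => f (y i) := by fun_prop
  have hpi (z : Z) : Measure.pi (fun _ : Fin n => (κ z).map f)
      = (Measure.pi fun _ : Fin n => κ z).map fun y i => f (y i) :=
    (Measure.pi_map_pi fun _ => hf.aemeasurable).symm
  refine ⟨fun z => Measure.isProbabilityMeasure_map hf.aemeasurable, fun E hE => ?_,
    fun E hE => ?_, hmono⟩
  · simp_rw [hpi, Measure.map_apply hf' hE]
    exact hμ.measurable _ (hf' hE)
  · simp_rw [hpi, Measure.map_apply hf' hE]
    exact hμ.apply _ (hf' hE)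

lemma map_neg (hμ : IsMonotoneMixture μ ν κ h) :
    IsMonotoneMixture (μ.map fun y i => -(y i)) ν (fun z => (κ z).map fun x => -x)
      fun z => -(h z) :=
  hμ.map measurable_neg fun z z' hz => (hμ.mono z' z (neg_le_neg_iff.1 hz)).map_neg

lemma real_apply (hμ : IsMonotoneMixture μ ν κ h) {E : Set (Fin n → ℝ)} (hE : MeasurableSet E) :
    μ.real E = ∫ z, (Measure.pi fun _ : Fin n => κ z).real E ∂ν := by
  have := hμ.prob
  rw [measureReal_def, hμ.apply E hE]
  exact (integral_toReal (hμ.measurable E hE).aemeasurable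
    (ae_of_all _ fun z => measure_lt_top _ _)).symm

lemma real_allBelow_eq (hμ : IsMonotoneMixture μ ν κ h) {S T : Finset (Fin n)}
    (hST : S.card = T.card) (t : ℝ) : μ.real (allBelow S t) = μ.real (allBelow T t) := by
  have := hμ.prob
  rw [measureReal_def, measureReal_def, hμ.apply _ (measurableSet_allBelow S t),
    hμ.apply _ (measurableSet_allBelow T t)]
  simp_rw [pi_allBelow, hST]

/-- Given z, D and the block S are independent. The probability of D decreases in h by stochastic
order, and so does the ratio of the probabilities that S is below s and below t, by `Iio_mul_Iio_le`
raised to the power |S|. -/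
lemma dependsPositively [IsProbabilityMeasure ν] (hμ : IsMonotoneMixture μ ν κ h)
    (S : Finset (Fin n)) : DependsPositively μ S := by
  intro D hD hlow hdep s t hst
  have := hμ.prob
  have hmeas {E : Set (Fin n → ℝ)} (hE : MeasurableSet E) :
      Measurable fun z => (Measure.pi fun _ : Fin n => κ z).real E :=
    (hμ.measurable E hE).ennreal_toReal
  have hIcc (E : Set (Fin n → ℝ)) (z : Z) :
      (Measure.pi fun _ : Fin n => κ z).real E ∈ Set.Icc (0 : ℝ) 1 :=
    ⟨measureReal_nonneg, measureReal_le_one⟩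
  have hS (r : ℝ) : MeasurableSet (allBelow S r) := measurableSet_allBelow S r
  have hfac (r : ℝ) (z : Z) : (Measure.pi fun _ : Fin n => κ z).real (D ∩ allBelow S r)
      = (Measure.pi fun _ : Fin n => κ z).real D
        * (Measure.pi fun _ : Fin n => κ z).real (allBelow S r) := by
    simp_rw [measureReal_def]
    rw [pi_inter_allBelow _ S hD hdep, ENNReal.toReal_mul]
  rw [hμ.real_apply (hD.inter (hS t)), hμ.real_apply (hD.inter (hS s)), hμ.real_apply (hS s),
    hμ.real_apply (hS t)]
  simp_rw [hfac]
  refine integral_mul_integral_le_of_antitone_ratio ν (h := h) (hmeas hD) (hmeas (hS s))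
    (hmeas (hS t)) (hIcc D) (hIcc _) (hIcc _) (fun z z' hz => ?_) fun z z' hz => ?_
  · exact ENNReal.toReal_mono (measure_ne_top _ _) (pi_le_pi_of_isLowerSet _ _
      (fun L hL => (hμ.mono z z' hz).measure_le_of_isLowerSet hL) hD hlow)
  · simp_rw [measureReal_def, pi_allBelow, ← ENNReal.toReal_mul, ← mul_pow]
    refine ENNReal.toReal_mono (by finiteness) ?_
    exact pow_le_pow_left₀ zero_le ((hμ.mono z z' hz).Iio_mul_Iio_le hst) _

end IsMonotoneMixture

end Mixture

/-! ### Likelihood ratio order for normal laws and their absolute values -/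

section GaussianOrder

lemma likelihoodRatioLE_dirac {x y : ℝ} (h : x ≤ y) :
    LikelihoodRatioLE (Measure.dirac x) (Measure.dirac y) := by
  intro A B hA hB hAB
  rw [Measure.dirac_apply' _ hA, Measure.dirac_apply' _ hB]
  by_cases hy : y ∈ A
  · have hx : x ∉ B := fun hx => (hAB y hy x hx).not_ge h
    simp [hx]
  · simp [hy]

lemma gaussianPDFReal_mul_le {z z' x y : ℝ} (v : NNReal) (hz : z ≤ z') (hxy : x ≤ y) :
    gaussianPDFReal z' v x * gaussianPDFReal z v y
      ≤ gaussianPDFReal z v x * gaussianPDFReal z' v y := by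
  simp only [gaussianPDFReal]
  rw [mul_mul_mul_comm, mul_mul_mul_comm _ _ _ (Real.exp (-(y - z') ^ 2 / _)), ← Real.exp_add,
    ← Real.exp_add, ← add_div, ← add_div]
  refine mul_le_mul_of_nonneg_left (Real.exp_le_exp.2
    (div_le_div_of_nonneg_right ?_ (by positivity))) (by positivity)
  nlinarith [mul_nonneg (sub_nonneg.2 hz) (sub_nonneg.2 hxy)]

lemma likelihoodRatioLE_gaussianReal {z z' : ℝ} (v : NNReal) (hz : z ≤ z') :
    LikelihoodRatioLE (gaussianReal z v) (gaussianReal z' v) := by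
  -- Variance zero occurs when ρ = 1; the laws are then point masses without density.
  rcases eq_or_ne v 0 with rfl | hv
  · simpa using likelihoodRatioLE_dirac hz
  intro A B hA hB hAB
  simp_rw [gaussianReal_apply _ hv]
  refine setLIntegral_mul_setLIntegral_le (measurable_gaussianPDF z v)
    (measurable_gaussianPDF z' v) hA hB fun x hx y hy => ?_
  simp_rw [gaussianPDF, ← ENNReal.ofReal_mul (gaussianPDFReal_nonneg _ _ _)]
  exact ENNReal.ofReal_le_ofReal (gaussianPDFReal_mul_le v hz (hAB x hx y hy).le)

/-- With nonnegative arguments, product-to-sum leaves xz' + yz ≤ xz + yz' and |xz' - yz| ≤ yz' - xz,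
whose gaps factor as the products `h1`, `h2`, `h3`. -/
lemma cosh_mul_cosh_le {x y z z' : ℝ} (hxy : |x| ≤ |y|) (hz : |z| ≤ |z'|) :
    Real.cosh (x * z') * Real.cosh (y * z) ≤ Real.cosh (x * z) * Real.cosh (y * z') := by
  have prod (s t : ℝ) : Real.cosh s * Real.cosh t = (Real.cosh (s + t) + Real.cosh (s - t)) / 2 := by
    rw [Real.cosh_add, Real.cosh_sub]
    ring
  rw [← Real.cosh_abs (x * z'), ← Real.cosh_abs (y * z), ← Real.cosh_abs (x * z),
    ← Real.cosh_abs (y * z')]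
  simp only [abs_mul]
  have hx := abs_nonneg x
  have hz0 := abs_nonneg z
  generalize |x| = x at *
  generalize |y| = y at *
  generalize |z| = z at *
  generalize |z'| = z' at *
  have h1 := mul_nonneg (sub_nonneg.2 hxy) (sub_nonneg.2 hz)
  have h2 := mul_nonneg (sub_nonneg.2 hxy) (add_nonneg hz0 (hz0.trans hz))
  have h3 := mul_nonneg (add_nonneg hx (hx.trans hxy)) (sub_nonneg.2 hz)
  rw [prod, prod]
  gcongr
  · rw [Real.cosh_le_cosh, abs_of_nonneg, abs_of_nonneg]
    · nlinarith
    · have := hx.trans hxy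
      have := hz0.trans hz
      positivity
    · have := hx.trans hxy
      have := hz0.trans hz
      positivity
  · rw [Real.cosh_le_cosh, abs_le, abs_of_nonpos (by nlinarith)]
    constructor <;> nlinarith

lemma gaussianPDFReal_add_neg (z x : ℝ) (v : NNReal) :
    gaussianPDFReal z v x + gaussianPDFReal z v (-x)
      = 2 * (√(2 * Real.pi * v))⁻¹ * Real.exp (-(x ^ 2 + z ^ 2) / (2 * v))
        * Real.cosh (x * (z / v)) := by
  have h1 : -(x - z) ^ 2 / (2 * (v : ℝ)) = -(x ^ 2 + z ^ 2) / (2 * v) + x * (z / v) := by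
    rcases eq_or_ne (v : ℝ) 0 with h | h
    · simp [h]
    · field_simp
      ring
  have h2 : -(-x - z) ^ 2 / (2 * (v : ℝ)) = -(x ^ 2 + z ^ 2) / (2 * v) + -(x * (z / v)) := by
    rcases eq_or_ne (v : ℝ) 0 with h | h
    · simp [h]
    · field_simp
      ring
  rw [gaussianPDFReal, gaussianPDFReal, h1, h2, Real.exp_add, Real.exp_add, Real.cosh_eq]
  ring

lemma symm_gaussianPDFReal_mul_le {z z' x y : ℝ} (v : NNReal) (hz : |z| ≤ |z'|)
    (hxy : |x| ≤ |y|) :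
    (gaussianPDFReal z' v x + gaussianPDFReal z' v (-x))
        * (gaussianPDFReal z v y + gaussianPDFReal z v (-y))
      ≤ (gaussianPDFReal z v x + gaussianPDFReal z v (-x))
        * (gaussianPDFReal z' v y + gaussianPDFReal z' v (-y)) := by
  simp_rw [gaussianPDFReal_add_neg]
  have hz' : |z / (v : ℝ)| ≤ |z' / (v : ℝ)| := by
    rw [abs_div, abs_div]
    gcongr
  rw [mul_mul_mul_comm, mul_mul_mul_comm (_ * _) (Real.cosh (x * (z / v)))]
  refine mul_le_mul (le_of_eq ?_) (cosh_mul_cosh_le hxy hz')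
    (mul_nonneg (Real.cosh_pos _).le (Real.cosh_pos _).le) (by positivity)
  rw [mul_mul_mul_comm, mul_mul_mul_comm _ _ _ (Real.exp (-(y ^ 2 + z' ^ 2) / _)), ← Real.exp_add,
    ← Real.exp_add]
  ring_nf

/-- The preimage is symmetric, so the density may be averaged with its reflection; this brings in
the cosh form without restricting to a half-line. -/
lemma gaussianReal_map_abs_apply {v : NNReal} (hv : v ≠ 0) (z : ℝ) {A : Set ℝ}
    (hA : MeasurableSet A) :
    (gaussianReal z v).map (fun x => |x|) A = ∫⁻ x in (fun x => |x|) ⁻¹' A,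
      ENNReal.ofReal (2⁻¹ * (gaussianPDFReal z v x + gaussianPDFReal z v (-x))) := by
  have hE : MeasurableSet ((fun x : ℝ => |x|) ⁻¹' A) := measurable_abs hA
  rw [Measure.map_apply measurable_abs hA, gaussianReal_apply _ hv]
  set E := (fun x : ℝ => |x|) ⁻¹' A with hEdef
  have hneg : ∫⁻ x in E, gaussianPDF z v (-x) = ∫⁻ x in E, gaussianPDF z v x := by
    have hpre : (fun x : ℝ => -x) ⁻¹' E = E := by
      ext x
      simp [hEdef]
    have := (Measure.measurePreserving_neg (volume : Measure ℝ)).setLIntegral_comp_preimage hE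
      (measurable_gaussianPDF z v)
    rw [← this]
    exact congrArg (fun F => ∫⁻ x in F, gaussianPDF z v (-x)) hpre.symm
  have hof (x : ℝ) : ENNReal.ofReal (2⁻¹ * (gaussianPDFReal z v x + gaussianPDFReal z v (-x)))
      = 2⁻¹ * (gaussianPDF z v x + gaussianPDF z v (-x)) := by
    rw [ENNReal.ofReal_mul (by norm_num), ENNReal.ofReal_add (gaussianPDFReal_nonneg _ _ _)
      (gaussianPDFReal_nonneg _ _ _), ENNReal.ofReal_inv_of_pos (by norm_num)]
    simp [gaussianPDF]
  have hm := measurable_gaussianPDF z v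
  simp_rw [hof]
  rw [lintegral_const_mul _ (by fun_prop), lintegral_add_left hm, hneg,
    ← two_mul, ← mul_assoc, ENNReal.inv_mul_cancel (by simp) (by simp), one_mul]

lemma likelihoodRatioLE_gaussianReal_map_abs {z z' : ℝ} (v : NNReal) (hz : |z| ≤ |z'|) :
    LikelihoodRatioLE ((gaussianReal z v).map fun x => |x|)
      ((gaussianReal z' v).map fun x => |x|) := by
  rcases eq_or_ne v 0 with rfl | hv
  · rw [gaussianReal_zero_var, gaussianReal_zero_var, Measure.map_dirac' measurable_abs,
      Measure.map_dirac' measurable_abs]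
    exact likelihoodRatioLE_dirac hz
  intro A B hA hB hAB
  simp_rw [gaussianReal_map_abs_apply hv _ hA, gaussianReal_map_abs_apply hv _ hB]
  have hm (z : ℝ) : Measurable fun x =>
      ENNReal.ofReal (2⁻¹ * (gaussianPDFReal z v x + gaussianPDFReal z v (-x))) := by
    have := measurable_gaussianPDFReal z v
    fun_prop
  have hnn (z x : ℝ) : 0 ≤ 2⁻¹ * (gaussianPDFReal z v x + gaussianPDFReal z v (-x)) :=
    mul_nonneg (by norm_num)
      (add_nonneg (gaussianPDFReal_nonneg _ _ _) (gaussianPDFReal_nonneg _ _ _))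
  refine setLIntegral_mul_setLIntegral_le (hm z) (hm z') (measurable_abs hA) (measurable_abs hB)
    fun x hx y hy => ?_
  simp_rw [← ENNReal.ofReal_mul (hnn _ _)]
  refine ENNReal.ofReal_le_ofReal ?_
  have := symm_gaussianPDFReal_mul_le v hz (hAB _ hx _ hy).le
  linarith

end GaussianOrder

/-! ### Symmetric normal vectors as a shared normal variable plus independent noise -/

section Representation

variable {Ω : Type*} [MeasurableSpace Ω] {P : Measure Ω} {n : ℕ} {X : Fin n → Ω → ℝ} {m σ ρ : ℝ}

/-- The right side involves only m, σ and ρ, so these determine the law. -/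
lemma IsSymmetricNormal.charFunDual_map_eq (hX : IsSymmetricNormal X m σ ρ P)
    (L : StrongDual ℝ (Fin n → ℝ)) :
    charFunDual (P.map fun ω i => X i ω) L = Complex.exp
      (((∑ i, L (fun j => if i = j then 1 else 0) * m : ℝ) : ℂ) * Complex.I
        - ((∑ i, ∑ j, L (fun l => if i = l then 1 else 0) * (L (fun l => if j = l then 1 else 0)
          * if i = j then σ ^ 2 else ρ * σ ^ 2) : ℝ) : ℂ) / 2) := by
  have := hX.gaussian.isProbabilityMeasure
  have hmem (i : Fin n) : MemLp (X i) 2 P := (hX.gaussian.eval i).memLp_two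
  have hL : (fun ω => L (fun i => X i ω))
      = fun ω => ∑ i, L (fun j => if i = j then 1 else 0) * X i ω := by
    ext ω
    have := LinearMap.pi_apply_eq_sum_univ L.toLinearMap fun i => X i ω
    simpa [mul_comm] using this
  have hmem' (i : Fin n) :
      MemLp (fun ω => L (fun j => if i = j then 1 else 0) * X i ω) 2 P := (hmem i).const_mul _
  rw [hX.gaussian.charFunDual_map_eq_fun L, hL, variance_fun_sum hmem',
    integral_finsetSum _ fun i _ => (hmem' i).integrable (by norm_num)]
  simp_rw [integral_const_mul, hX.mean, covariance_const_mul_left, covariance_const_mul_right]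
  congr! 8 with i _ j _
  split_ifs with hij
  · rw [hij, covariance_self (hmem j).aemeasurable, hX.var]
  · exact hX.cov i j hij

lemma IsSymmetricNormal.map_eq {Ω' : Type*} [MeasurableSpace Ω'] {Q : Measure Ω'}
    {Y : Fin n → Ω' → ℝ} (hX : IsSymmetricNormal X m σ ρ P) (hY : IsSymmetricNormal Y m σ ρ Q) :
    P.map (fun ω i => X i ω) = Q.map (fun ω i => Y i ω) := by
  have := hX.gaussian.isGaussian_map
  have := hY.gaussian.isGaussian_map
  refine Measure.ext_of_charFunDual ?_
  ext L
  rw [hX.charFunDual_map_eq, hY.charFunDual_map_eq]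

lemma isGaussian_pi_gaussianReal (b : NNReal) :
    IsGaussian (Measure.pi fun _ : Fin n => gaussianReal 0 b) := by
  have h := iIndepFun.hasGaussianLaw (P := Measure.pi fun _ : Fin n => gaussianReal 0 b)
    (X := fun i (y : Fin n → ℝ) => y i)
    (fun i => ⟨by
      rw [(measurePreserving_eval (fun _ : Fin n => gaussianReal 0 b) i).map_eq]
      infer_instance⟩)
    (iIndepFun_pi (X := fun _ => id) fun _ => aemeasurable_id)
  simpa using h.isGaussian_map

lemma isSymmetricNormal_fst_add_snd {a b : NNReal} (ha : a = ρ * σ ^ 2)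
    (hab : (a : ℝ) + b = σ ^ 2) :
    IsSymmetricNormal (fun (i : Fin n) (q : ℝ × (Fin n → ℝ)) => q.1 + q.2 i) m σ ρ
      ((gaussianReal m a).prod (Measure.pi fun _ => gaussianReal 0 b)) := by
  set π := Measure.pi fun _ : Fin n => gaussianReal 0 b with hπ
  have : IsGaussian π := isGaussian_pi_gaussianReal b
  have hid (z : ℝ) (v : NNReal) : MemLp (fun x : ℝ => x) 2 (gaussianReal z v) :=
    memLp_id_gaussianReal' 2 (by simp)
  have heval (i : Fin n) : MeasurePreserving (Function.eval i) π (gaussianReal 0 b) :=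
    measurePreserving_eval _ i
  have hπi (i : Fin n) : MemLp (fun y : Fin n → ℝ => y i) 2 π :=
    (hid 0 b).comp_measurePreserving (heval i)
  have hfst : MemLp (fun q : ℝ × (Fin n → ℝ) => q.1) 2 ((gaussianReal m a).prod π) :=
    (hid m a).comp_fst π
  have hsnd (i : Fin n) :
      MemLp (fun q : ℝ × (Fin n → ℝ) => q.2 i) 2 ((gaussianReal m a).prod π) :=
    (hπi i).comp_snd (gaussianReal m a)
  have hvarπ (i : Fin n) : Var[fun y : Fin n → ℝ => y i; π] = b := by
    have := variance_map (X := fun x : ℝ => x) (μ := π) (Y := Function.eval i) (by fun_prop)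
      (heval i).aemeasurable
    rw [(heval i).map_eq, variance_fun_id_gaussianReal] at this
    exact this.symm
  have hcovπ (i j : Fin n) :
      cov[fun y : Fin n → ℝ => y i, fun y => y j; π] = if i = j then (b : ℝ) else 0 := by
    split_ifs with hij
    · rw [hij, covariance_self (hπi j).aemeasurable, hvarπ]
    · have hind : iIndepFun (fun (i : Fin n) (y : Fin n → ℝ) => y i) π :=
        iIndepFun_pi (X := fun _ => id) fun _ => aemeasurable_id
      exact (hind.indepFun hij).covariance_eq_zero (hπi i) (hπi j)
  have hcov (i j : Fin n) :
      cov[fun q : ℝ × (Fin n → ℝ) => q.1 + q.2 i, fun q => q.1 + q.2 j; (gaussianReal m a).prod π]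
        = a + if i = j then (b : ℝ) else 0 := by
    have h11 : cov[fun q : ℝ × (Fin n → ℝ) => q.1, fun q => q.1; (gaussianReal m a).prod π] = a := by
      rw [covariance_self hfst.aemeasurable]
      have := variance_map (X := fun x : ℝ => x) (μ := (gaussianReal m a).prod π) (Y := Prod.fst)
        (by fun_prop) (by fun_prop)
      rw [measurePreserving_fst.map_eq, variance_fun_id_gaussianReal] at this
      exact this.symm
    have h12 (l : Fin n) :
        cov[fun q : ℝ × (Fin n → ℝ) => q.1, fun q => q.2 l; (gaussianReal m a).prod π] = 0 :=
      covariance_fst_snd_prod (hid m a) (hπi l)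
    have h22 : cov[fun q : ℝ × (Fin n → ℝ) => q.2 i, fun q => q.2 j; (gaussianReal m a).prod π]
        = if i = j then (b : ℝ) else 0 := by
      have := covariance_map_fun (X := fun y : Fin n → ℝ => y i) (Y := fun y => y j)
        (μ := (gaussianReal m a).prod π) (Z := Prod.snd)
        (measurable_pi_apply i).aestronglyMeasurable (measurable_pi_apply j).aestronglyMeasurable
        (by fun_prop)
      rw [measurePreserving_snd.map_eq, hcovπ] at this
      exact this.symm
    have hadd := covariance_add_left hfst (hsnd i) (hfst.add (hsnd j))
    rw [covariance_add_right hfst hfst (hsnd j), covariance_add_right (hsnd i) hfst (hsnd j),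
      covariance_comm (fun q : ℝ × (Fin n → ℝ) => q.2 i), h11, h12, h12, h22] at hadd
    rw [add_zero, zero_add] at hadd
    exact hadd
  refine ⟨⟨?_⟩, fun i => ?_, fun i => ?_, fun i j hij => ?_⟩
  · let Λ : ℝ × (Fin n → ℝ) →L[ℝ] (Fin n → ℝ) := ContinuousLinearMap.pi fun i =>
      ContinuousLinearMap.fst ℝ ℝ (Fin n → ℝ)
        + (ContinuousLinearMap.proj i).comp (ContinuousLinearMap.snd ℝ ℝ (Fin n → ℝ))
    exact isGaussian_map (μ := (gaussianReal m a).prod π) Λ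
  · rw [integral_add (hfst.integrable (by norm_num)) ((hsnd i).integrable (by norm_num)),
      integral_fun_fst (fun x : ℝ => x), integral_fun_snd (fun y : Fin n → ℝ => y i)]
    have : ∫ y, y i ∂π = 0 := by
      have := integral_map (μ := π) (φ := Function.eval i) (f := fun x : ℝ => x)
        (heval i).aemeasurable
        (by fun_prop)
      rw [(heval i).map_eq, integral_id_gaussianReal] at this
      exact this.symm
    simp [this]
  · refine (covariance_self (hfst.add (hsnd i)).aemeasurable).symm.trans ?_
    exact (hcov i i).trans (by simp [hab])
  · rw [hcov i j, if_neg hij, add_zero, ha]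

lemma isMonotoneMixture_fst_add_snd (a b : NNReal) :
    IsMonotoneMixture
      (((gaussianReal m a).prod (Measure.pi fun _ => gaussianReal 0 b)).map
        fun (q : ℝ × (Fin n → ℝ)) i => q.1 + q.2 i)
      (gaussianReal m a) (fun z => gaussianReal z b) id := by
  have hmeas : Measurable fun (q : ℝ × (Fin n → ℝ)) i => q.1 + q.2 i := by fun_prop
  have hpi (z : ℝ) {E : Set (Fin n → ℝ)} (hE : MeasurableSet E) :
      Measure.pi (fun _ : Fin n => gaussianReal z b) E
        = Measure.pi (fun _ : Fin n => gaussianReal 0 b)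
          (Prod.mk z ⁻¹' ((fun (q : ℝ × (Fin n → ℝ)) i => q.1 + q.2 i) ⁻¹' E)) := by
    have h : gaussianReal z b = (gaussianReal 0 b).map (z + ·) := by
      rw [gaussianReal_map_const_add, zero_add]
    rw [h, ← Measure.pi_map_pi (fun _ => by fun_prop), Measure.map_apply (by fun_prop) hE]
    rfl
  refine ⟨fun z => inferInstance, fun E hE => ?_, fun E hE => ?_,
    fun z z' hz => likelihoodRatioLE_gaussianReal b hz⟩
  · simp_rw [hpi _ hE]
    exact measurable_measure_prodMk_left (hmeas hE)
  · simp_rw [hpi _ hE]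
    rw [Measure.map_apply hmeas hE, Measure.prod_apply (hmeas hE)]

lemma IsSymmetricNormal.rho_le_one (hσ : 0 < σ) (hX : IsSymmetricNormal X m σ ρ P) {i j : Fin n}
    (hij : i ≠ j) : ρ ≤ 1 := by
  have := hX.gaussian.isProbabilityMeasure
  have h := variance_sub (hX.gaussian.eval i).memLp_two (hX.gaussian.eval j).memLp_two
  rw [hX.var, hX.var, hX.cov i j hij] at h
  have h0 := variance_nonneg (X i - X j) P
  rw [h] at h0
  by_contra! hlt
  nlinarith [mul_pos (sub_pos.2 hlt) (pow_pos hσ 2)]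

/-- A symmetric normal vector with nonnegative correlation has conditionally independent
coordinates given a common normal component. -/
lemma IsSymmetricNormal.exists_isMonotoneMixture (hσ : 0 < σ) (hρ : 0 ≤ ρ)
    (hX : IsSymmetricNormal X m σ ρ P) : ∃ a b : NNReal,
      IsMonotoneMixture (P.map fun ω i => X i ω) (gaussianReal m a) (fun z => gaussianReal z b)
        id := by
  wlog hρ1 : ρ ≤ 1 generalizing ρ
  · refine this le_rfl ⟨hX.gaussian, hX.mean, hX.var, fun i j hij => ?_⟩ zero_le_one
    -- If ρ > 1 there are no two distinct indices, so the covariance condition is vacuous and ρ may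
    -- be replaced by 0.
    exact absurd (hX.rho_le_one hσ hij) hρ1
  have ha : 0 ≤ ρ * σ ^ 2 := by positivity
  have hb : 0 ≤ (1 - ρ) * σ ^ 2 := mul_nonneg (sub_nonneg.2 hρ1) (by positivity)
  refine ⟨(ρ * σ ^ 2).toNNReal, ((1 - ρ) * σ ^ 2).toNNReal, ?_⟩
  rw [hX.map_eq (isSymmetricNormal_fst_add_snd (b := ((1 - ρ) * σ ^ 2).toNNReal)
    (Real.coe_toNNReal _ ha)
    (by rw [Real.coe_toNNReal _ ha, Real.coe_toNNReal _ hb]; ring))]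
  exact isMonotoneMixture_fst_add_snd _ _

end Representation

/-! ### Order statistics as counts -/

section OrderStatistics

variable {n : ℕ}

lemma orderStat_lt_iff (y : Fin n → ℝ) (i : Fin n) (t : ℝ) :
    orderStat y i < t ↔ (i : ℕ) + 1 ≤ (Finset.univ.filter fun l => y l < t).card := by
  have h := Tuple.lt_card_lt_iff_apply_lt_of_monotone (j := i) (a := t) (Tuple.monotone_sort y)
  have hcard : (Finset.univ.filter fun l => (y ∘ Tuple.sort y) l < t).card
      = (Finset.univ.filter fun l => y l < t).card :=
    Finset.card_equiv (Tuple.sort y) (by simp)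
  rw [hcard] at h
  exact h.symm

lemma lt_orderStat_iff (y : Fin n → ℝ) (i : Fin n) (t : ℝ) :
    t < orderStat y i ↔ n - (i : ℕ) ≤ (Finset.univ.filter fun l => -y l < -t).card := by
  have h := Tuple.lt_card_le_iff_apply_le_of_monotone (j := i) (a := t) (Tuple.monotone_sort y)
  have hcard : (Finset.univ.filter fun l => (y ∘ Tuple.sort y) l ≤ t).card
      = (Finset.univ.filter fun l => y l ≤ t).card :=
    Finset.card_equiv (Tuple.sort y) (by simp)
  rw [hcard] at h
  have hsum := Finset.card_filter_add_card_filter_not (s := (Finset.univ : Finset (Fin n)))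
    fun l => y l ≤ t
  simp only [not_le, Finset.card_univ, Fintype.card_fin] at hsum
  simp only [neg_lt_neg_iff]
  rw [← not_le]
  change ¬ ((y ∘ Tuple.sort y) i ≤ t) ↔ _
  rw [← h]
  have := i.isLt
  omega

lemma forall_le_orderStat_iff {k : ℕ} (hk : 1 ≤ k) (a : ℕ → ℝ) (y : Fin n → ℝ) :
    (∀ i : Fin n, k ≤ (i : ℕ) + 1 → a (i + 1) ≤ orderStat y i)
      ↔ y ∉ someCountExceeds a Finset.univ 0 k := by
  rw [← not_iff_not, not_not]
  push Not
  simp_rw [orderStat_lt_iff]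
  constructor
  · rintro ⟨i, hki, hi⟩
    exact ⟨i + 1, hki, i.isLt, by simpa using hi⟩
  · rintro ⟨j, hkj, hjn, hj⟩
    obtain ⟨i, rfl⟩ : ∃ i, j = i + 1 := ⟨j - 1, by omega⟩
    exact ⟨⟨i, hjn⟩, hkj, by simpa using hj⟩

lemma forall_orderStat_le_iff {k : ℕ} (hk : 1 ≤ k) (hkn : k ≤ n) (b : ℕ → ℝ) (y : Fin n → ℝ) :
    (∀ i : Fin n, (i : ℕ) + 1 ≤ n - k + 1 → orderStat y i ≤ b (i + 1))
      ↔ (fun l => -y l) ∉ someCountExceeds (fun j => -b (n - j + 1)) Finset.univ 0 k := by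
  rw [← not_iff_not, not_not]
  push Not
  simp_rw [lt_orderStat_iff]
  constructor
  · rintro ⟨i, hki, hi⟩
    have := i.isLt
    -- With positions starting at 0, entry i is the (n - i)-th largest, so j = n - i and the bound b
    -- (n - j + 1) is b (i + 1).
    refine ⟨n - i, by omega, Nat.sub_le _ _, ?_⟩
    simp only [zero_add]
    rwa [show n - (n - (i : ℕ)) = i by omega]
  · rintro ⟨j, hkj, hjn, hj⟩
    refine ⟨⟨n - j, by omega⟩, by simp only; omega, ?_⟩
    simp only [zero_add] at hj
    rwa [show n - (n - j) = j by omega]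

end OrderStatistics

/-! ### From laws on coordinates to the Simes statements -/

section Simes

variable {Ω : Type*} [MeasurableSpace Ω] {P : Measure Ω} {n : ℕ}
  {Y : Fin n → Ω → ℝ}

lemma measureReal_preimage (hY : AEMeasurable (fun ω i => Y i ω) P) {E : Set (Fin n → ℝ)}
    (hE : MeasurableSet E) : P.real {ω | (fun i => Y i ω) ∈ E} = (P.map fun ω i => Y i ω).real E := by
  rw [measureReal_def, measureReal_def, Measure.map_apply_of_aemeasurable hY hE]
  rfl

lemma IsSymmetricNormal.measure_eq_zero {X : Fin n → Ω → ℝ} {m σ ρ : ℝ} (hσ : 0 < σ)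
    (hX : IsSymmetricNormal X m σ ρ P) (i : Fin n) (t : ℝ) : P {ω | X i ω = t} = 0 := by
  have hi := hX.gaussian.eval i
  have := nullSingletonClass_gaussianReal (μ := ∫ ω, X i ω ∂P) (v := (Var[X i; P]).toNNReal)
    (by rw [hX.var]; simpa using hσ.ne')
  have h0 : P.map (X i) {t} = 0 := by
    rw [hi.map_eq_gaussianReal]
    exact measure_singleton t
  rwa [Measure.map_apply_of_aemeasurable hi.aemeasurable (measurableSet_singleton t)] at h0

/-- Absence of atoms makes the weak inequality in the cdf and the strict one in `allBelow`
interchangeable. -/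
lemma maxCdf_eq (hY : AEMeasurable (fun ω i => Y i ω) P) (hatom : ∀ i t, P {ω | Y i ω = t} = 0)
    (S : Finset (Fin n)) (hS : S.Nonempty) (t : ℝ) :
    maxCdf Y P S hS t = (P.map fun ω i => Y i ω).real (allBelow S t) := by
  rw [← measureReal_preimage hY (measurableSet_allBelow S t), maxCdf]
  refine measureReal_congr ?_
  have hne : ∀ᵐ ω ∂P, ∀ i, Y i ω ≠ t := ae_all_iff.2 fun i => by
    simpa [ae_iff] using hatom i t
  filter_upwards [hne] with ω hω
  refine propext ?_
  change S.sup' hS (fun i => Y i ω) ≤ t ↔ ∀ i ∈ S, Y i ω < t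
  rw [Finset.sup'_le_iff]
  exact forall₂_congr fun i _ => ⟨fun h => lt_of_le_of_ne h (hω i), le_of_lt⟩

variable [IsProbabilityMeasure P]

lemma one_sub_minCdf_eq (hY : AEMeasurable (fun ω i => -Y i ω) P)
    (S : Finset (Fin n)) (hS : S.Nonempty) (t : ℝ) :
    1 - minCdf Y P S hS t = (P.map fun ω i => -Y i ω).real (allBelow S (-t)) := by
  have := Measure.isProbabilityMeasure_map hY
  have h : minCdf Y P S hS t = (P.map fun ω i => -Y i ω).real (allBelow S (-t))ᶜ := by
    rw [← measureReal_preimage (Y := fun i ω => -Y i ω) hY (measurableSet_allBelow S _).compl,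
      minCdf]
    congr 1
    ext ω
    simp [allBelow]
  rw [h, probReal_compl_eq_one_sub (measurableSet_allBelow S _), sub_sub_cancel]

lemma measureReal_notMem (hY : AEMeasurable (fun ω i => Y i ω) P) {E : Set (Fin n → ℝ)}
    (hE : MeasurableSet E) :
    P.real {ω | (fun i => Y i ω) ∉ E} = 1 - (P.map fun ω i => Y i ω).real E := by
  have := Measure.isProbabilityMeasure_map hY
  rw [← probReal_compl_eq_one_sub hE]
  exact measureReal_preimage hY hE.compl

lemma measureReal_inter_allBelow (hind : iIndepFun Y P)
    (hY : AEMeasurable (fun ω i => Y i ω) P) (S : Finset (Fin n)) (D : Set (Fin n → ℝ))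
    (hD : MeasurableSet D)
    (hdep : ∀ y z : Fin n → ℝ, (∀ i ∈ Sᶜ, y i = z i) → y ∈ D → z ∈ D) (t : ℝ) :
    (P.map fun ω i => Y i ω).real (D ∩ allBelow S t)
      = (P.map fun ω i => Y i ω).real D * (P.map fun ω i => Y i ω).real (allBelow S t) := by
  have hYi : ∀ i, AEMeasurable (Y i) P := aemeasurable_pi_iff.1 hY
  have (i : Fin n) : IsProbabilityMeasure (P.map (Y i)) := Measure.isProbabilityMeasure_map (hYi i)
  rw [(iIndepFun_iff_map_fun_eq_pi_map hYi).1 hind]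
  simp_rw [measureReal_def]
  rw [pi_inter_allBelow _ S hD hdep, ENNReal.toReal_mul]

variable {Z : Type*} [MeasurableSpace Z] {ν : Measure Z} [IsProbabilityMeasure ν]
  {κ : Z → Measure ℝ} {h : Z → ℝ}

lemma IsMonotoneMixture.simesLower (hY : AEMeasurable (fun ω i => Y i ω) P)
    (hμ : IsMonotoneMixture (P.map fun ω i => Y i ω) ν κ h)
    (hatom : ∀ i t, P {ω | Y i ω = t} = 0) {k : ℕ} (hk : 1 ≤ k) (hkn : k ≤ n)
    (S : Finset (Fin n)) (hS : S.Nonempty) (hSk : S.card = k) :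
    SimesLower Y P k (maxCdf Y P S hS) := by
  have := Measure.isProbabilityMeasure_map hY
  intro a ha hα
  have hp (T : Finset (Fin n)) (hT : T.card = k) (t : ℝ) :
      (P.map fun ω i => Y i ω).real (allBelow T t) = maxCdf Y P S hS t := by
    rw [maxCdf_eq hY hatom, hμ.real_allBelow_eq (hT.trans hSk.symm)]
  simp_rw [forall_le_orderStat_iff hk]
  rw [measureReal_notMem hY (measurableSet_someCountExceeds _ _ _ _)]
  constructor
  · have := measureReal_someCountExceeds_le _ hkn _ hp (fun T _ => hμ.dependsPositively T) a ha hα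
    linarith
  · intro hind hconst
    rw [measureReal_someCountExceeds_eq _ hkn _ hp
      (measureReal_inter_allBelow hind hY) a ha hconst]

lemma IsMonotoneMixture.simesUpper (hY : AEMeasurable (fun ω i => -Y i ω) P)
    (hμ : IsMonotoneMixture (P.map fun ω i => -Y i ω) ν κ h)
    {k : ℕ} (hk : 1 ≤ k) (hkn : k ≤ n)
    (S : Finset (Fin n)) (hS : S.Nonempty) (hSk : S.card = k) :
    SimesUpper Y P k (minCdf Y P S hS) := by
  have := Measure.isProbabilityMeasure_map hY
  intro b hb hα
  have hp (T : Finset (Fin n)) (hT : T.card = k) (t : ℝ) :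
      (P.map fun ω i => -Y i ω).real (allBelow T t) = 1 - minCdf Y P S hS (-t) := by
    rw [one_sub_minCdf_eq hY, neg_neg, hμ.real_allBelow_eq (hT.trans hSk.symm)]
  have ha : MonotoneOn (fun j => -b (n - j + 1)) (Set.Icc k n) := fun i hi j hj hij =>
    neg_le_neg (hb ⟨by omega, by have := hj.1; omega⟩ ⟨by omega, by have := hi.1; omega⟩ (by omega))
  simp_rw [forall_orderStat_le_iff hk hkn]
  rw [measureReal_notMem (Y := fun i ω => -Y i ω) hY (measurableSet_someCountExceeds _ _ _ _)]
  constructor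
  · have := measureReal_someCountExceeds_le _ hkn _ hp (fun T _ => hμ.dependsPositively T) _ ha
      (by simpa only [neg_neg] using hα)
    simp only [neg_neg, Nat.sub_self, zero_add] at this
    linarith
  · intro hind hconst
    have hneg : iIndepFun (fun i ω => -Y i ω) P :=
      hind.comp (fun _ x => -x) fun _ => measurable_neg
    rw [measureReal_someCountExceeds_eq _ hkn _ hp
      (measureReal_inter_allBelow hneg hY) _ ha (by simpa only [neg_neg] using hconst)]
    simp

theorem IsMonotoneMixture.generalizedSimes (hY : AEMeasurable (fun ω i => Y i ω) P)
    (hμ : IsMonotoneMixture (P.map fun ω i => Y i ω) ν κ h)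
    (hatom : ∀ i t, P {ω | Y i ω = t} = 0) : GeneralizedSimes Y P := by
  have hY' : AEMeasurable (fun ω i => -Y i ω) P := hY.neg
  have hμ' : IsMonotoneMixture (P.map fun ω i => -Y i ω) ν (fun z => (κ z).map fun x => -x)
      fun z => -(h z) := by
    have hneg : Measurable fun (y : Fin n → ℝ) i => -y i := measurable_neg
    have := hμ.map_neg
    rwa [AEMeasurable.map_map_of_aemeasurable hneg.aemeasurable hY] at this
  intro k hk hkn S hS hSk
  refine ⟨fun T hT hTk => ⟨?_, ?_⟩, hμ.simesLower hY hatom hk hkn S hS hSk,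
    hμ'.simesUpper hY' hk hkn S hS hSk⟩
  · ext t
    rw [maxCdf_eq hY hatom, maxCdf_eq hY hatom, hμ.real_allBelow_eq (hTk.trans hSk.symm)]
  · ext t
    rw [← sub_right_inj (a := 1), one_sub_minCdf_eq hY', one_sub_minCdf_eq hY',
      hμ'.real_allBelow_eq (hTk.trans hSk.symm)]

end Simes

theorem proposition2p1 {Ω : Type*} [MeasurableSpace Ω] (P : Measure Ω) [IsProbabilityMeasure P]
    {n : ℕ} (X : Fin n → Ω → ℝ) (m σ ρ : ℝ) (hσ : 0 < σ) (hρ : 0 ≤ ρ)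
    (hX : IsSymmetricNormal X m σ ρ P) :
    GeneralizedSimes X P ∧
      (m = 0 → GeneralizedSimes (fun i ω => |X i ω|) P) := by
  obtain ⟨a, b, hμ⟩ := hX.exists_isMonotoneMixture hσ hρ
  have hmeas := hX.gaussian.aemeasurable
  refine ⟨hμ.generalizedSimes hmeas (hX.measure_eq_zero hσ), fun _ => ?_⟩
  -- The same mixing law serves for absolute values, with the parameter reordered by |z|.
  have hμ' := hμ.map measurable_abs (h' := fun z => |z|)
    fun z z' hz => likelihoodRatioLE_gaussianReal_map_abs b hz
  have hmeas' : Measurable fun (y : Fin n → ℝ) i => |y i| :=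
    measurable_pi_lambda _ fun i => (measurable_pi_apply i).abs
  rw [AEMeasurable.map_map_of_aemeasurable hmeas'.aemeasurable hmeas] at hμ'
  refine IsMonotoneMixture.generalizedSimes (hmeas'.comp_aemeasurable hmeas) hμ' fun i t => ?_
  refine measure_mono_null (t := {ω | X i ω = t} ∪ {ω | X i ω = -t}) (fun ω hω => ?_)
    (measure_union_null (hX.measure_eq_zero hσ i t) (hX.measure_eq_zero hσ i (-t)))
  have hω' : |X i ω| = t := hω
  rcases abs_choice (X i ω) with h | h
  · exact Or.inl (h.symm.trans hω')
  · exact Or.inr (by change X i ω = -t; linarith)
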